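/- Let $W(\mathbb R)$ be the set of functions $f:\mathbb R\to\mathbb C$ of the form $f(x)=\int_{\mathbb R}e^{ixy}\,d\mu(y)$, where $\mu$ is a complex Borel measure on $\mathbb R$ of finite total variation, with $\|f\|_W=\operatorname{var}\mu$ (the measure $\mu$ is uniquely determined by $f$). Let $W^+(\mathbb R)$ be the set of those $f$ for which $\mu$ can be taken to be a finite positive measure, let $W_0(\mathbb R)$ be the set of functions $f(x)=\int_{\mathbb R}e^{ixy}g(y)\,dy$ with $g\in L_1(\mathbb R)$, and let $W_1(\mathbb R)$ be the set of functions $c+f_0$ with $c\in\mathbb C$ and $f_0\in W_0(\mathbb R)$. For $f:\mathbb R\to\mathbb C$ let $\ell_f$ be the continuous function that satisfies $\ell_f(k)=f(k)$ for all $k\in\mathbb Z$ and is linear on every interval $[k,k+1]$, $k\in\mathbb Z$. Theorem. If $f\in W(\mathbb R)$, then $\ell_f\in W(\mathbb R)$ and $\|\ell_f\|_W\le\|f\|_W$. This inequality is sharp on the whole class: the constant $1$ cannot be replaced by a smaller one, and moreover, for every $f\in W(\mathbb R)$, the dilations $f_h(x)=f(hx)$, $h>0$, satisfy $\lim_{h\to0+}\|\ell_{f_h}\|_W=\|f\|_W$.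 If $f$ belongs to $W_0(\mathbb R)$, to $W_1(\mathbb R)$ or to $W^+(\mathbb R)$, then $\ell_f$ belongs to the same class. -/

import Mathlib

open MeasureTheory Set Filter Topology
open scoped ENNReal

namespace WienerAlgebra

/-- The function `f` is the Fourier integral `f(x) = ∫ e^{ixy} dμ(y)` of the complex Borel
measure `μ` on the real line, whose total variation is finite. -/
def IsFourierIntegralOf (f : ℝ → ℂ) (μ : ComplexMeasure ℝ) : Prop :=
  μ.variation univ < ∞ ∧
    ∀ x : ℝ, f x = μ.integral (fun y : ℝ => Complex.exp (Complex.I * x * y))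
      (ContinuousLinearMap.mul ℝ ℂ)

/-- The Wiener algebra `W(ℝ)`. -/
def W : Set (ℝ → ℂ) :=
  {f | ∃ μ : ComplexMeasure ℝ, IsFourierIntegralOf f μ}

/-- The Wiener algebra `W₀(ℝ)` of Fourier integrals of Lebesgue integrable functions. -/
def W₀ : Set (ℝ → ℂ) :=
  {f | ∃ g : ℝ → ℂ, Integrable g ∧
    ∀ x : ℝ, f x = ∫ y : ℝ, Complex.exp (Complex.I * x * y) * g y}

/-- The Wiener algebra `W₁(ℝ)`: constants plus elements of `W₀(ℝ)`. -/
def W₁ : Set (ℝ → ℂ) :=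
  {f | ∃ c : ℂ, ∃ f₀ ∈ W₀, ∀ x : ℝ, f x = c + f₀ x}

/-- The class `W⁺(ℝ)` of Fourier integrals of finite positive Borel measures. -/
def Wplus : Set (ℝ → ℂ) :=
  {f | ∃ μ : Measure ℝ, IsFiniteMeasure μ ∧
    ∀ x : ℝ, f x = ∫ y : ℝ, Complex.exp (Complex.I * x * y) ∂μ}

/-- The norm of `W(ℝ)`: the total variation of the complex measure that represents `f`.
At most one measure represents `f`, so the infimum runs over a single measure if `f` is
in `W(ℝ)` (see `normW_eq`), and it is `∞` if `f` is not in `W(ℝ)`. -/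
noncomputable def normW (f : ℝ → ℂ) : ℝ≥0∞ :=
  ⨅ (μ : ComplexMeasure ℝ) (_ : IsFourierIntegralOf f μ), μ.variation univ

/-- The `f`-zigzag: the continuous function that agrees with `f` at the integers and is linear
between consecutive integers. -/
noncomputable def zigzag (f : ℝ → ℂ) (x : ℝ) : ℂ :=
  f (⌊x⌋ : ℤ) + (Int.fract x : ℝ) * (f ((⌊x⌋ + 1 : ℤ) : ℝ) - f (⌊x⌋ : ℤ))

/-- The exponential is integrable against a vector measure of finite variation. -/
theorem integrable_exp {V : Type*} [NormedAddCommGroup V] (μ : VectorMeasure ℝ V)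
    (hμ : μ.variation univ < ∞) (x : ℝ) :
    μ.Integrable (fun y : ℝ => Complex.exp (Complex.I * x * y)) := by
  have : IsFiniteMeasure μ.variation := ⟨hμ⟩
  refine Integrable.of_bound (C := 1) (by fun_prop) (Eventually.of_forall fun y => ?_)
  rw [Complex.norm_exp]
  simp

/-- The integral of the exponential against a signed measure. -/
noncomputable def signedTransform (s : SignedMeasure ℝ) (x : ℝ) : ℂ :=
  s.integral (fun y : ℝ => Complex.exp (Complex.I * x * y)) (ContinuousLinearMap.lsmul ℝ ℝ).flip

theorem signed_variation_lt_top (s : SignedMeasure ℝ) : s.variation univ < ∞ := by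
  rw [← SignedMeasure.totalVariation_eq_variation]
  exact measure_lt_top _ _

theorem integral_eq_re_add_im (μ : ComplexMeasure ℝ) (hμ : μ.variation univ < ∞) (x : ℝ) :
    μ.integral (fun y : ℝ => Complex.exp (Complex.I * x * y)) (ContinuousLinearMap.mul ℝ ℂ) =
      signedTransform (ComplexMeasure.re μ) x +
        Complex.I * signedTransform (ComplexMeasure.im μ) x := by
  set e : ℝ → ℂ := fun y : ℝ => Complex.exp (Complex.I * x * y) with he
  have hi : Integrable e μ.variation := integrable_exp μ hμ x
  have hre : (ComplexMeasure.re μ).variation ≤ (1 : ℝ≥0∞) • μ.variation := by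
    rw [one_smul]
    refine VectorMeasure.variation_le_of_forall_enorm_le fun E _ =>
      le_trans ?_ (VectorMeasure.enorm_measure_le_variation μ E)
    simp only [ComplexMeasure.re_apply]
    rw [enorm_le_iff_norm_le]
    exact Complex.abs_re_le_norm _
  have him : (ComplexMeasure.im μ).variation ≤ (1 : ℝ≥0∞) • μ.variation := by
    rw [one_smul]
    refine VectorMeasure.variation_le_of_forall_enorm_le fun E _ =>
      le_trans ?_ (VectorMeasure.enorm_measure_le_variation μ E)
    simp only [ComplexMeasure.im_apply]
    rw [enorm_le_iff_norm_le]
    exact Complex.abs_im_le_norm _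
  set P : ℂ →L[ℝ] ℝ →L[ℝ] ℂ := (ContinuousLinearMap.lsmul ℝ ℝ).flip with hP
  set Q : ℂ →L[ℝ] ℝ →L[ℝ] ℂ :=
    (ContinuousLinearMap.compL ℝ ℝ ℂ ℂ (ContinuousLinearMap.mul ℝ ℂ Complex.I)) ∘L P with hQ
  have hsum : ContinuousLinearMap.mul ℝ ℂ =
      P.bilinearComp (ContinuousLinearMap.id ℝ ℂ) Complex.reCLM +
        Q.bilinearComp (ContinuousLinearMap.id ℝ ℂ) Complex.imCLM := by
    ext a b
    conv_lhs => rw [ContinuousLinearMap.mul_apply', ← Complex.re_add_im b]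
    simp only [hP, hQ, add_apply, ContinuousLinearMap.bilinearComp_apply,
      ContinuousLinearMap.coe_id', id_eq, ContinuousLinearMap.flip_apply,
      ContinuousLinearMap.lsmul_apply, Complex.reCLM_apply, Complex.imCLM_apply,
      ContinuousLinearMap.comp_apply, ContinuousLinearMap.compL_apply,
      ContinuousLinearMap.mul_apply', Complex.real_smul]
    ring
  have h1 : μ.integral e (P.bilinearComp (ContinuousLinearMap.id ℝ ℂ) Complex.reCLM) =
      (ComplexMeasure.re μ).integral e P :=
    setToFun_congr_measure_of_integrable 1 ENNReal.one_ne_top hre _ _ e hi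
  have h2 : μ.integral e (Q.bilinearComp (ContinuousLinearMap.id ℝ ℂ) Complex.imCLM) =
      (ComplexMeasure.im μ).integral e Q :=
    setToFun_congr_measure_of_integrable 1 ENNReal.one_ne_top him _ _ e hi
  have h3 : Complex.I * (ComplexMeasure.im μ).integral e P =
      (ComplexMeasure.im μ).integral e Q :=
    VectorMeasure.continuousLinearMap_apply_integral
      (C := ContinuousLinearMap.mul ℝ ℂ Complex.I)
      (integrable_exp _ (signed_variation_lt_top _) x)
  rw [hsum, VectorMeasure.integral_add_cbm hi, h1, h2, ← h3]
  rfl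

theorem signedTransform_eq_sub (s : SignedMeasure ℝ) (x : ℝ) :
    signedTransform s x =
      charFun s.toJordanDecomposition.posPart x - charFun s.toJordanDecomposition.negPart x := by
  have h := SignedMeasure.toSignedMeasure_toJordanDecomposition s
  conv_lhs => rw [← h]
  have hp : ∀ m : Measure ℝ, [IsFiniteMeasure m] → signedTransform m.toSignedMeasure x = charFun m x := by
    intro m _
    rw [signedTransform, VectorMeasure.integral_toSignedMeasure, charFun_apply_real]
    congr with y
    ring_nf
  rw [← hp, ← hp]
  simp only [signedTransform, JordanDecomposition.toSignedMeasure]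
  exact VectorMeasure.integral_sub_vectorMeasure
    (integrable_exp _ (signed_variation_lt_top _) x) (integrable_exp _ (signed_variation_lt_top _) x)

theorem signedTransform_neg (s : SignedMeasure ℝ) (x : ℝ) :
    signedTransform s (-x) = (starRingEnd ℂ) (signedTransform s x) := by
  simp only [signedTransform_eq_sub, charFun_neg, map_sub]

theorem signed_eq_zero (s : SignedMeasure ℝ) (h : ∀ x, signedTransform s x = 0) : s = 0 := by
  rw [← SignedMeasure.toSignedMeasure_toJordanDecomposition s, JordanDecomposition.toSignedMeasure]
  have : s.toJordanDecomposition.posPart = s.toJordanDecomposition.negPart := by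
    apply Measure.ext_of_charFun
    ext x
    have := h x
    rw [signedTransform_eq_sub] at this
    exact sub_eq_zero.1 this
  simp [this]

/-- A complex measure of finite variation is determined by its Fourier integral. -/
theorem IsFourierIntegralOf.unique {f : ℝ → ℂ} {μ ν : ComplexMeasure ℝ}
    (hμ : IsFourierIntegralOf f μ) (hν : IsFourierIntegralOf f ν) : μ = ν := by
  have hd : (μ - ν).variation univ < ∞ :=
    lt_of_le_of_lt (VectorMeasure.variation_sub_le univ) (ENNReal.add_lt_top.2 ⟨hμ.1, hν.1⟩)
  have h0 : ∀ x : ℝ, signedTransform (ComplexMeasure.re (μ - ν)) x +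
      Complex.I * signedTransform (ComplexMeasure.im (μ - ν)) x = 0 := by
    intro x
    rw [← integral_eq_re_add_im _ hd, VectorMeasure.integral_sub_vectorMeasure
      (integrable_exp _ hμ.1 x) (integrable_exp _ hν.1 x), ← hμ.2 x, ← hν.2 x, sub_self]
  have h1 : ∀ x : ℝ, signedTransform (ComplexMeasure.re (μ - ν)) x -
      Complex.I * signedTransform (ComplexMeasure.im (μ - ν)) x = 0 := by
    intro x
    have h := congrArg (starRingEnd ℂ) (h0 (-x))
    simp only [signedTransform_neg, map_add, map_mul, Complex.conj_conj, Complex.conj_I,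
      map_zero] at h
    linear_combination h
  have hre := signed_eq_zero (ComplexMeasure.re (μ - ν)) fun x => by
    linear_combination (h0 x + h1 x) / 2
  have him := signed_eq_zero (ComplexMeasure.im (μ - ν)) fun x => by
    linear_combination (-Complex.I / 2) * (h0 x - h1 x) +
      signedTransform (ComplexMeasure.im (μ - ν)) x * Complex.I_mul_I
  have := ComplexMeasure.toComplexMeasure_to_signedMeasure (μ - ν)
  rw [hre, him] at this
  rw [← sub_eq_zero, ← this]
  ext s
  simp [SignedMeasure.toComplexMeasure_apply]
  rfl

/-- The norm is the total variation of the measure that represents the function. -/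
theorem normW_eq {f : ℝ → ℂ} {μ : ComplexMeasure ℝ} (hμ : IsFourierIntegralOf f μ) :
    normW f = μ.variation univ :=
  le_antisymm (iInf₂_le μ hμ) (le_iInf₂ fun ν hν => by rw [hμ.unique hν])

end WienerAlgebra

/-!
On `[0, 1)` the quotient of the zigzag of the character `t ↦ e^{ity}` by the character itself has
the Fourier coefficients `sinc²(y/2 + πn)`. These are nonnegative and sum to the value `1` of the
zigzag at `0`, so the zigzag of a character is an average of the characters with frequencies
`y + 2πn`. Hence `zigzag` moves the representing measure by a Markov kernel. Such a kernel does not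
increase the total variation and keeps positivity, and as it only adds countably many translates,
it keeps absolute continuity.

For the limit, couple each frequency `hy` of `f_h` with its random image under the kernel. The two
differ with probability at most `1 - sinc²(hy/2)`, which tends to `0` with `h`, and the norms of
`f_h` and of its zigzag differ by at most twice the mass on which the coupled frequencies differ.
-/

namespace WienerAlgebra

open scoped Real ProbabilityTheory
open ProbabilityTheory (Kernel IsMarkovKernel)

section VectorMeasureWithDensity

open NormedSpace (normalize)

variable {X E F G : Type*} [MeasurableSpace X] {M : Measure X}
  [NormedAddCommGroup E] [NormedSpace ℝ E] [NormedAddCommGroup F] [NormedSpace ℝ F]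
  [NormedAddCommGroup G] [NormedSpace ℝ G] {g : X → F}

theorem norm_normalize_le_one (v : F) : ‖normalize v‖ ≤ 1 := by
  rw [NormedSpace.normalize, norm_smul, norm_inv, norm_norm]
  exact inv_mul_le_one

theorem aestronglyMeasurable_normalize (hg : AEStronglyMeasurable g M) :
    AEStronglyMeasurable (fun x => normalize (g x)) M :=
  hg.norm.aemeasurable.inv.aestronglyMeasurable.smul hg

theorem integral_withDensity_enorm_normalize (hg : AEStronglyMeasurable g M)
    (B : E →L[ℝ] F →L[ℝ] G) (f : X → E) :
    ∫ x, B (f x) (normalize (g x)) ∂M.withDensity (‖g ·‖ₑ) = ∫ x, B (f x) (g x) ∂M := by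
  rw [integral_withDensity_eq_integral_toReal_smul₀ hg.enorm (.of_forall fun _ => enorm_lt_top)]
  simp only [toReal_enorm, ← map_smul, NormedSpace.norm_smul_normalize]

theorem isFiniteMeasure_variation_withDensityᵥ [CompleteSpace F] (hg : Integrable g M) :
    IsFiniteMeasure (M.withDensityᵥ g).variation := by
  rw [Measure.variation_withDensityᵥ hg]
  exact isFiniteMeasure_withDensity hg.2.ne

theorem variation_withDensityᵥ_univ [CompleteSpace F] (hg : Integrable g M) :
    (M.withDensityᵥ g).variation univ = ∫⁻ x, ‖g x‖ₑ ∂M := by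
  rw [Measure.variation_withDensityᵥ hg, withDensity_apply _ .univ, Measure.restrict_univ]

theorem continuous_integral_bilin_of_bdd [CompleteSpace G] (B : E →L[ℝ] F →L[ℝ] G) {s : X → F}
    {C : ℝ} (hs : AEStronglyMeasurable s M) (hC : ∀ᵐ x ∂M, ‖s x‖ ≤ C) :
    Continuous fun f : X →₁[M] E => ∫ x, B (f x) (s x) ∂M := by
  have hs' : MemLp s ∞ M := memLp_top_of_bound hs C hC
  refine ((B.lpPairing M 1 ∞).flip hs'.toLp).continuous.congr fun f => ?_
  rw [ContinuousLinearMap.flip_apply, ContinuousLinearMap.lpPairing_eq_integral]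
  refine integral_congr_ae ?_
  filter_upwards [hs'.coeFn_toLp] with x hx
  rw [hx]

-- The right-hand side is continuous in `f` because it pairs `f` with the bounded function `g / ‖g‖`
-- against the variation `‖g‖ M`.
theorem integral_withDensityᵥ [CompleteSpace F] [CompleteSpace G] (hg : Integrable g M)
    (B : E →L[ℝ] F →L[ℝ] G) {f : X → E} (hf : (M.withDensityᵥ g).Integrable f) :
    ∫ᵛ x, f x ∂[B; M.withDensityᵥ g] = ∫ x, B (f x) (g x) ∂M := by
  have := isFiniteMeasure_variation_withDensityᵥ hg
  have hvar : (M.withDensityᵥ g).variation = M.withDensity (‖g ·‖ₑ) :=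
    Measure.variation_withDensityᵥ hg
  have hmeas : AEStronglyMeasurable (fun x => normalize (g x)) (M.withDensityᵥ g).variation := by
    rw [hvar]
    exact (aestronglyMeasurable_normalize hg.1).mono_ac (withDensity_absolutelyContinuous _ _)
  have hbound := Eventually.of_forall (f := ae (M.withDensityᵥ g).variation)
    fun x => norm_normalize_le_one (g x)
  have hint {u : X → E} (hu : (M.withDensityᵥ g).Integrable u) :=
    B.integrable_of_bilin_of_bdd_right 1 hu hmeas hbound
  rw [← integral_withDensity_enorm_normalize hg.1, ← hvar]
  refine Integrable.induction (fun f => ∫ᵛ x, f x ∂[B; M.withDensityᵥ g] =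
    ∫ x, B (f x) (normalize (g x)) ∂(M.withDensityᵥ g).variation) ?_ ?_ ?_ ?_ hf
  · intro c s hs _
    rw [VectorMeasure.integral_indicator_const _ hs, hvar,
      integral_withDensity_enorm_normalize hg.1, withDensityᵥ_apply hg hs,
      ← (B c).integral_comp_comm hg.integrableOn, ← integral_indicator hs]
    congr with x
    by_cases hx : x ∈ s <;> simp [hx]
  · intro u v _ hu hv ihu ihv
    simp only [Pi.add_apply, map_add, add_apply]
    rw [VectorMeasure.integral_fun_add hu hv, ihu, ihv, integral_add (hint hu) (hint hv)]
  · exact isClosed_eq VectorMeasure.continuous_integral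
      (continuous_integral_bilin_of_bdd B hmeas hbound)
  · intro u v huv _ ih
    rw [← VectorMeasure.integral_congr_ae huv, ih]
    refine integral_congr_ae ?_
    filter_upwards [huv] with x hx
    rw [hx]

theorem withDensityᵥ_complexRnDeriv_eq {ν : ComplexMeasure X} [SigmaFinite M]
    (h : ν ≪ᵥ M.toENNRealVectorMeasure) : M.withDensityᵥ (ν.rnDeriv M) = ν := by
  obtain ⟨hre, him⟩ := (ComplexMeasure.absolutelyContinuous_ennreal_iff _ _).1 h
  have hint : Integrable (ν.rnDeriv M) M := ComplexMeasure.integrable_rnDeriv ν M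
  have apply_eq {s : SignedMeasure X} (hs : s ≪ᵥ M.toENNRealVectorMeasure) {A : Set X}
      (hA : MeasurableSet A) : ∫ x in A, s.rnDeriv M x ∂M = s A := by
    rw [← withDensityᵥ_apply (SignedMeasure.integrable_rnDeriv s M) hA,
      SignedMeasure.withDensityᵥ_rnDeriv_eq s M hs]
  ext A hA
  rw [withDensityᵥ_apply hint hA]
  apply Complex.ext
  · exact (integral_re hint.integrableOn).symm.trans (apply_eq hre hA)
  · exact (integral_im hint.integrableOn).symm.trans (apply_eq him hA)

end VectorMeasureWithDensity

theorem norm_exp_I_mul_mul (x y : ℝ) : ‖Complex.exp (Complex.I * x * y)‖ = 1 := by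
  simp [Complex.norm_exp]

theorem IsFourierIntegralOf.add {f₁ f₂ : ℝ → ℂ} {μ₁ μ₂ : ComplexMeasure ℝ}
    (h₁ : IsFourierIntegralOf f₁ μ₁) (h₂ : IsFourierIntegralOf f₂ μ₂) :
    IsFourierIntegralOf (f₁ + f₂) (μ₁ + μ₂) := by
  refine ⟨(VectorMeasure.variation_add_le univ).trans_lt (ENNReal.add_lt_top.2 ⟨h₁.1, h₂.1⟩),
    fun x => ?_⟩
  rw [VectorMeasure.integral_add_vectorMeasure (integrable_exp _ h₁.1 x)
    (integrable_exp _ h₂.1 x), ← h₁.2, ← h₂.2, Pi.add_apply]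

theorem normW_add_le (f₁ f₂ : ℝ → ℂ) : normW (f₁ + f₂) ≤ normW f₁ + normW f₂ :=
  ENNReal.le_iInf₂_add_iInf₂ fun _ h₁ _ h₂ =>
    (iInf₂_le _ (h₁.add h₂)).trans (VectorMeasure.variation_add_le univ)

section FourierPushforward

variable {X : Type*} [MeasurableSpace X] {M : Measure X} {φ ψ : X → ℝ} {g : X → ℂ}

/-- The Fourier integral of the image under `φ` of the complex measure with density `g` with
respect to `M`. Elements of `W(ℝ)` are handled in this form, because a change of the map `φ`
describes the effect of dilations and of `zigzag`. -/
noncomputable def fourierPushforward (M : Measure X) (φ : X → ℝ) (g : X → ℂ) (x : ℝ) : ℂ :=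
  ∫ p, Complex.exp (Complex.I * x * φ p) * g p ∂M

theorem integrable_exp_mul (hφ : Measurable φ) (hg : Integrable g M) (x : ℝ) :
    Integrable (fun p => Complex.exp (Complex.I * x * φ p) * g p) M :=
  hg.bdd_mul (c := 1) (by fun_prop) (.of_forall fun p => (norm_exp_I_mul_mul x (φ p)).le)

theorem isFourierIntegralOf_fourierPushforward (hφ : Measurable φ) (hg : Integrable g M) :
    IsFourierIntegralOf (fourierPushforward M φ g) ((M.withDensityᵥ g).map φ) := by
  have := isFiniteMeasure_variation_withDensityᵥ hg
  refine ⟨(VectorMeasure.variation_map_le univ).trans_lt (measure_lt_top _ _), fun x => ?_⟩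
  have hint : (M.withDensityᵥ g).Integrable fun p => Complex.exp (Complex.I * x * φ p) :=
    Integrable.of_bound (C := 1) (by fun_prop)
      (.of_forall fun p => (norm_exp_I_mul_mul x (φ p)).le)
  have hmeas : AEStronglyMeasurable (fun y : ℝ => Complex.exp (Complex.I * x * y))
      ((M.withDensityᵥ g).variation.map φ) := by fun_prop
  exact (integral_withDensityᵥ hg (.mul ℝ ℂ) hint).symm.trans
    (VectorMeasure.integral_map hφ hmeas hint).symm

theorem fourierPushforward_mem_W (hφ : Measurable φ) (hg : Integrable g M) :
    fourierPushforward M φ g ∈ W :=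
  ⟨_, isFourierIntegralOf_fourierPushforward hφ hg⟩

theorem normW_fourierPushforward_le (hφ : Measurable φ) (hg : Integrable g M) :
    normW (fourierPushforward M φ g) ≤ ∫⁻ p, ‖g p‖ₑ ∂M := by
  rw [normW_eq (isFourierIntegralOf_fourierPushforward hφ hg), ← variation_withDensityᵥ_univ hg]
  exact (VectorMeasure.variation_map_le univ).trans_eq (Measure.map_apply hφ .univ)

theorem normW_fourierPushforward (hφ : MeasurableEmbedding φ) (hg : Integrable g M) :
    normW (fourierPushforward M φ g) = ∫⁻ p, ‖g p‖ₑ ∂M := by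
  rw [normW_eq (isFourierIntegralOf_fourierPushforward hφ.measurable hg), hφ.variation_map,
    Measure.map_apply hφ.measurable .univ, preimage_univ, variation_withDensityᵥ_univ hg]

theorem fourierPushforward_comp_mul (M : Measure X) (φ : X → ℝ) (g : X → ℂ) (h : ℝ) :
    (fun x => fourierPushforward M φ g (h * x)) = fourierPushforward M (fun p => h * φ p) g := by
  ext x
  simp only [fourierPushforward, Complex.ofReal_mul, mul_assoc, mul_left_comm (x : ℂ)]

theorem fourierPushforward_eq_add_restrict_ne (hφ : Measurable φ) (hψ : Measurable ψ)
    (hg : Integrable g M) :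
    fourierPushforward M φ g = fourierPushforward M ψ g +
      (fourierPushforward (M.restrict {p | φ p ≠ ψ p}) φ g +
        fourierPushforward (M.restrict {p | φ p ≠ ψ p}) ψ (-g)) := by
  ext x
  have hφx := integrable_exp_mul hφ hg x
  have hψx := integrable_exp_mul hψ hg x
  have hsub := setIntegral_eq_integral_of_forall_compl_eq_zero (μ := M) (s := {p | φ p ≠ ψ p})
    (f := fun p => Complex.exp (Complex.I * x * φ p) * g p -
      Complex.exp (Complex.I * x * ψ p) * g p)
    fun p hp => by rw [not_not.1 hp, sub_self]
  rw [integral_sub hφx hψx, integral_sub hφx.restrict hψx.restrict] at hsub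
  simp only [fourierPushforward, Pi.add_apply, Pi.neg_apply, mul_neg, integral_neg]
  linear_combination -hsub

theorem normW_fourierPushforward_le_add (hφ : Measurable φ) (hψ : Measurable ψ)
    (hg : Integrable g M) :
    normW (fourierPushforward M φ g) ≤
      normW (fourierPushforward M ψ g) + 2 * ∫⁻ p in {p | φ p ≠ ψ p}, ‖g p‖ₑ ∂M := by
  have hφ' := normW_fourierPushforward_le hφ (hg.restrict (s := {p | φ p ≠ ψ p}))
  have hψ' := normW_fourierPushforward_le hψ (hg.neg.restrict (s := {p | φ p ≠ ψ p}))
  simp only [Pi.neg_apply, enorm_neg] at hψ'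
  rw [fourierPushforward_eq_add_restrict_ne hφ hψ hg, two_mul]
  exact (normW_add_le _ _).trans (by grw [normW_add_le, hφ', hψ'])

end FourierPushforward

theorem IsFourierIntegralOf.exists_eq_fourierPushforward {f : ℝ → ℂ} {μ : ComplexMeasure ℝ}
    (hf : IsFourierIntegralOf f μ) {m : Measure ℝ} [SigmaFinite m]
    (hμ : μ ≪ᵥ m.toENNRealVectorMeasure) :
    ∃ g : ℝ → ℂ, Integrable g m ∧ f = fourierPushforward m id g := by
  have hg : Integrable (μ.rnDeriv m) m := ComplexMeasure.integrable_rnDeriv μ m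
  refine ⟨μ.rnDeriv m, hg, funext fun x => ?_⟩
  have hint := integrable_exp _ hf.1 x
  rw [← withDensityᵥ_complexRnDeriv_eq hμ] at hf hint
  rw [hf.2, integral_withDensityᵥ hg _ hint]
  rfl

theorem exists_eq_fourierPushforward_of_mem_W {f : ℝ → ℂ} (hf : f ∈ W) :
    ∃ (m : Measure ℝ) (_ : IsFiniteMeasure m) (g : ℝ → ℂ),
      Integrable g m ∧ f = fourierPushforward m id g := by
  obtain ⟨μ, hμ⟩ := hf
  have : IsFiniteMeasure μ.variation := ⟨hμ.1⟩
  exact ⟨μ.variation, this, hμ.exists_eq_fourierPushforward (VectorMeasure.absolutelyContinuous μ)⟩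

theorem mem_W₀_iff {f : ℝ → ℂ} :
    f ∈ W₀ ↔ ∃ g : ℝ → ℂ, Integrable g ∧ f = fourierPushforward volume id g := by
  simp only [W₀, mem_ofPred_eq, funext_iff, fourierPushforward, id]

theorem normW_comp_mul {f : ℝ → ℂ} (hf : f ∈ W) {h : ℝ} (hh : h ≠ 0) :
    normW (fun x => f (h * x)) = normW f := by
  obtain ⟨m, _, g, hg, rfl⟩ := exists_eq_fourierPushforward_of_mem_W hf
  rw [fourierPushforward_comp_mul, normW_fourierPushforward .id hg]
  exact normW_fourierPushforward (measurableEmbedding_mulLeft₀ hh) hg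

section ZigzagOfCharacter

theorem sinc_sq_le_one_div_sq {x : ℝ} (hx : x ≠ 0) : Real.sinc x ^ 2 ≤ 1 / x ^ 2 := by
  rw [Real.sinc_of_ne_zero hx, div_pow]
  gcongr
  exact Real.sin_sq_le_one x

theorem sinc_half_sq {a : ℝ} (ha : a ≠ 0) :
    Real.sinc (a / 2) ^ 2 = (2 - 2 * Real.cos a) / a ^ 2 := by
  rw [Real.sinc_of_ne_zero (by simpa using ha), div_pow, Real.sin_sq_eq_half_sub]
  field_simp

/-- The weight that the zigzag of the character `t ↦ e^{ity}` gives to the character with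
frequency `y + 2πn`. -/
noncomputable def zigzagWeight (y : ℝ) (n : ℤ) : ℝ := Real.sinc (y / 2 + π * n) ^ 2

theorem zigzagWeight_nonneg (y : ℝ) (n : ℤ) : 0 ≤ zigzagWeight y n := sq_nonneg _

theorem continuous_zigzagWeight (n : ℤ) : Continuous fun y => zigzagWeight y n :=
  (Real.continuous_sinc.comp (by fun_prop)).pow 2

theorem summable_zigzagWeight (y : ℝ) : Summable (zigzagWeight y) := by
  have hinj : Function.Injective fun n : ℤ => y / 2 + π * n := fun a b h => by
    simpa [Real.pi_ne_zero] using h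
  refine (((Real.summable_one_div_int_add_rpow (y / (2 * π)) 2).2 one_lt_two).mul_left
    (1 / π ^ 2)).of_norm_bounded_eventually ?_
  filter_upwards [hinj.tendsto_cofinite.eventually (eventually_cofinite_ne 0)] with n hn
  rw [Real.norm_of_nonneg (zigzagWeight_nonneg y n)]
  refine (sinc_sq_le_one_div_sq hn).trans_eq ?_
  rw [Real.rpow_two, sq_abs, one_div_mul_one_div, ← mul_pow]
  congr 2
  field_simp
  ring

/-- The quotient of the zigzag of the character `t ↦ e^{ity}` by the character itself, as a function
of the fractional part `t` of the argument. -/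
noncomputable def zigzagMultiplier (y t : ℝ) : ℂ :=
  Complex.exp (-(Complex.I * y) * t) * (1 + t * (Complex.exp (Complex.I * y) - 1))

theorem zigzag_exp (y x : ℝ) :
    zigzag (fun t : ℝ => Complex.exp (Complex.I * t * y)) x =
      Complex.exp (Complex.I * x * y) * zigzagMultiplier y (Int.fract x) := by
  have hx : (x : ℂ) = ⌊x⌋ + (Int.fract x : ℝ) := by exact_mod_cast (Int.floor_add_fract x).symm
  have hexp : Complex.exp (Complex.I * x * y) * Complex.exp (-(Complex.I * y) * (Int.fract x : ℝ)) =
      Complex.exp (Complex.I * ⌊x⌋ * y) := by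
    rw [← Complex.exp_add, hx]
    ring_nf
  rw [zigzagMultiplier, ← mul_assoc, hexp]
  simp only [zigzag]
  push_cast
  rw [mul_add_one, add_mul, Complex.exp_add]
  ring

theorem integral_exp_mul_one_add_mul {c : ℂ} (hc : c ≠ 0) (β : ℂ) :
    ∫ t in (0 : ℝ)..1, Complex.exp (c * t) * (1 + t * β) =
      Complex.exp c * ((1 + β) / c - β / c ^ 2) - (1 / c - β / c ^ 2) := by
  have hderiv (t : ℝ) : HasDerivAt
      (fun t : ℝ => Complex.exp (c * t) * ((1 + t * β) / c - β / c ^ 2))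
      (Complex.exp (c * t) * (1 + t * β)) t := by
    have hid : HasDerivAt (fun t : ℝ => (t : ℂ)) 1 t := Complex.ofRealCLM.hasDerivAt
    refine ((hid.const_mul c).cexp.mul
      ((((hid.mul_const β).const_add 1).div_const c).sub_const (β / c ^ 2))).congr_deriv ?_
    field_simp
    ring
  rw [intervalIntegral.integral_eq_sub_of_hasDerivAt (fun t _ => hderiv t)
    (Continuous.intervalIntegrable (by fun_prop) _ _)]
  simp

theorem integral_zigzagMultiplier (a : ℝ) :
    ∫ t in (0 : ℝ)..1, zigzagMultiplier a t = (Real.sinc (a / 2) ^ 2 : ℝ) := by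
  rcases eq_or_ne a 0 with rfl | ha
  · simp [zigzagMultiplier]
  have ha' : (a : ℂ) ^ 2 = -(-(Complex.I * a)) ^ 2 := by
    rw [neg_sq, mul_pow, Complex.I_sq, neg_one_mul, neg_neg]
  have hcos : 2 * Complex.cos a = Complex.exp (Complex.I * a) + Complex.exp (-(Complex.I * a)) := by
    rw [Complex.two_cos, ← neg_mul, mul_comm (a : ℂ), mul_comm (-(a : ℂ)), neg_mul, mul_neg]
  have hexp : Complex.exp (Complex.I * a) * Complex.exp (-(Complex.I * a)) = 1 := by
    rw [← Complex.exp_add, add_neg_cancel, Complex.exp_zero]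
  have hc : -(Complex.I * a) ≠ 0 := by simp [ha]
  simp only [zigzagMultiplier]
  rw [integral_exp_mul_one_add_mul hc, sinc_half_sq ha]
  push_cast
  rw [hcos, ha']
  generalize -(Complex.I * a) = c at *
  field_simp
  linear_combination (c - 1) * hexp

theorem fourierCoeff_liftIco_zigzagMultiplier (y : ℝ) (n : ℤ) :
    fourierCoeff (AddCircle.liftIco 1 0 (zigzagMultiplier y)) n = zigzagWeight y n := by
  have hexp : Complex.exp (Complex.I * (y + 2 * π * n : ℝ)) = Complex.exp (Complex.I * y) := by
    rw [← Complex.exp_periodic.int_mul n (Complex.I * y)]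
    push_cast
    ring_nf
  rw [fourierCoeff_liftIco_eq, fourierCoeffOn_eq_integral, zigzagWeight,
    show y / 2 + π * n = (y + 2 * π * n) / 2 by ring, ← integral_zigzagMultiplier]
  simp only [zero_add, sub_zero, div_one, one_smul]
  refine intervalIntegral.integral_congr fun t _ => ?_
  simp only [zigzagMultiplier, fourier_coe_apply, smul_eq_mul]
  rw [hexp, ← mul_assoc, ← Complex.exp_add]
  push_cast
  ring_nf

theorem continuous_liftIco_zigzagMultiplier (y : ℝ) :
    Continuous (AddCircle.liftIco 1 0 (zigzagMultiplier y)) := by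
  refine AddCircle.liftIco_zero_continuous ?_ ?_
  · simp [zigzagMultiplier, ← Complex.exp_add]
  · unfold zigzagMultiplier
    fun_prop

theorem hasSum_zigzagWeight_mul_fourier (y : ℝ) {t : ℝ} (ht : t ∈ Ico 0 1) :
    HasSum (fun n : ℤ => (zigzagWeight y n : ℂ) * Complex.exp (2 * π * Complex.I * n * t))
      (zigzagMultiplier y t) := by
  let F : C(AddCircle (1 : ℝ), ℂ) := ⟨_, continuous_liftIco_zigzagMultiplier y⟩
  have hcoeff : fourierCoeff F = fun n => (zigzagWeight y n : ℂ) :=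
    funext (fourierCoeff_liftIco_zigzagMultiplier y)
  have hsum : Summable (fourierCoeff F) :=
    hcoeff ▸ Complex.summable_ofReal.2 (summable_zigzagWeight y)
  have h := has_pointwise_sum_fourier_series_of_summable hsum (t : AddCircle (1 : ℝ))
  have hF : F t = zigzagMultiplier y t :=
    AddCircle.liftIco_zero_coe_apply (f := zigzagMultiplier y) ht
  rw [hF, hcoeff] at h
  simpa [fourier_coe_apply] using h

theorem hasSum_zigzagWeight_mul_exp (y x : ℝ) :
    HasSum (fun n : ℤ => (zigzagWeight y n : ℂ) *
        Complex.exp (Complex.I * x * (y + 2 * π * n : ℝ)))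
      (zigzag (fun t : ℝ => Complex.exp (Complex.I * t * y)) x) := by
  rw [zigzag_exp]
  convert! (hasSum_zigzagWeight_mul_fourier y ⟨Int.fract_nonneg x, Int.fract_lt_one x⟩).mul_left
    (Complex.exp (Complex.I * x * y)) using 2 with n
  rw [mul_left_comm, ← Complex.exp_add, ← Complex.exp_periodic.int_mul (-(n * ⌊x⌋))]
  congr 2
  rw [Int.fract]
  push_cast
  ring

theorem hasSum_zigzagWeight (y : ℝ) : HasSum (zigzagWeight y) 1 := by
  rw [← Complex.hasSum_ofReal]
  simpa [zigzag] using hasSum_zigzagWeight_mul_exp y 0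

end ZigzagOfCharacter

section CompProd

variable {X Y : Type*} [MeasurableSpace X] [MeasurableSpace Y] {M : Measure X} [SFinite M]
  (κ : Kernel X Y) [IsMarkovKernel κ]

theorem measurePreserving_fst_compProd : MeasurePreserving Prod.fst (M ⊗ₘ κ) M :=
  ⟨measurable_fst, M.fst_compProd κ⟩

theorem integrable_comp_fst_compProd {E : Type*} [NormedAddCommGroup E] {g : X → E}
    (hg : Integrable g M) : Integrable (g ∘ Prod.fst) (M ⊗ₘ κ) :=
  (measurePreserving_fst_compProd κ).integrable_comp_of_integrable hg

theorem setLIntegral_compProd_comp_fst {f : X → ℝ≥0∞} (hf : AEMeasurable f M) {s : Set (X × Y)}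
    (hs : MeasurableSet s) :
    ∫⁻ p in s, f p.1 ∂(M ⊗ₘ κ) = ∫⁻ x, κ x (Prod.mk x ⁻¹' s) * f x ∂M := by
  have hae : ∀ᵐ p ∂(M ⊗ₘ κ), f p.1 = hf.mk f p.1 :=
    (measurePreserving_fst_compProd κ).quasiMeasurePreserving.ae hf.ae_eq_mk
  have hmeas : Measurable fun p : X × Y => hf.mk f p.1 := hf.measurable_mk.comp measurable_fst
  rw [lintegral_congr_ae (ae_restrict_of_ae hae), ← lintegral_indicator hs,
    Measure.lintegral_compProd (hmeas.indicator hs)]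
  refine lintegral_congr_ae ?_
  filter_upwards [hf.ae_eq_mk] with x hx
  rw [hx, mul_comm, ← lintegral_indicator_const (hs.preimage measurable_prodMk_left)]
  rfl

end CompProd

section ZigzagKernel

/-- The Markov kernel that sends the frequency `y` to `y + 2πn` with probability
`zigzagWeight y n`. If `μ` represents `f`, then the image of `μ` under this kernel represents
`zigzag f`. -/
noncomputable def zigzagKernel : Kernel ℝ ℝ where
  toFun y := Measure.sum fun n : ℤ =>
    ENNReal.ofReal (zigzagWeight y n) • Measure.dirac (y + 2 * π * n)
  measurable' := by
    refine Measure.measurable_of_measurable_coe _ fun s hs => ?_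
    simp only [Measure.sum_apply _ hs, Measure.smul_apply, smul_eq_mul, Measure.dirac_apply' _ hs]
    refine Measurable.tsum fun n => ?_
    have hw := (continuous_zigzagWeight n).measurable
    have : Measurable (s.indicator (1 : ℝ → ℝ≥0∞)) := measurable_one.indicator hs
    fun_prop

theorem zigzagKernel_apply (y : ℝ) :
    zigzagKernel y = Measure.sum fun n : ℤ =>
      ENNReal.ofReal (zigzagWeight y n) • Measure.dirac (y + 2 * π * n) := rfl

theorem zigzagKernel_apply_apply (y : ℝ) {s : Set ℝ} (hs : MeasurableSet s) :
    zigzagKernel y s = ∑' n : ℤ,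
      ENNReal.ofReal (zigzagWeight y n) * s.indicator 1 (y + 2 * π * n) := by
  simp only [zigzagKernel_apply, Measure.sum_apply _ hs, Measure.smul_apply, smul_eq_mul,
    Measure.dirac_apply' _ hs]

instance : IsMarkovKernel zigzagKernel where
  isProbabilityMeasure y := ⟨by
    simp only [zigzagKernel_apply_apply y .univ, indicator_univ, Pi.one_apply, mul_one]
    rw [← ENNReal.ofReal_tsum_of_nonneg (zigzagWeight_nonneg y) (summable_zigzagWeight y),
      (hasSum_zigzagWeight y).tsum_eq, ENNReal.ofReal_one]⟩

theorem zigzagKernel_compl_singleton_le (y : ℝ) :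
    zigzagKernel y {y}ᶜ ≤ ENNReal.ofReal (1 - zigzagWeight y 0) := by
  have h : ENNReal.ofReal (zigzagWeight y 0) ≤ zigzagKernel y {y} := by
    rw [zigzagKernel_apply_apply y (measurableSet_singleton y)]
    refine le_trans ?_ (ENNReal.le_tsum 0)
    simp
  rw [prob_compl_eq_one_sub (measurableSet_singleton y),
    ENNReal.ofReal_sub _ (zigzagWeight_nonneg y 0), ENNReal.ofReal_one]
  exact tsub_le_tsub_left h 1

theorem integral_exp_zigzagKernel (y x : ℝ) :
    ∫ z : ℝ, Complex.exp (Complex.I * x * z) ∂zigzagKernel y =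
      zigzag (fun t : ℝ => Complex.exp (Complex.I * t * y)) x := by
  have hweight (n : ℤ) : (ENNReal.ofReal (zigzagWeight y n)).toReal = zigzagWeight y n :=
    ENNReal.toReal_ofReal (zigzagWeight_nonneg y n)
  rw [zigzagKernel_apply, integral_sum_dirac_eq_tsum fun _ => ENNReal.ofReal_ne_top]
  · simp only [hweight, Complex.real_smul]
    exact (hasSum_zigzagWeight_mul_exp y x).tsum_eq
  · simpa only [hweight, norm_exp_I_mul_mul, mul_one] using summable_zigzagWeight y

theorem zigzagKernel_comp_volume_absolutelyContinuous :
    zigzagKernel ∘ₘ (volume : Measure ℝ) ≪ volume := by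
  refine Measure.AbsolutelyContinuous.mk fun s hs h0 => ?_
  have hae (n : ℤ) : ∀ᵐ y : ℝ, y + 2 * π * n ∉ s :=
    (measurePreserving_add_right volume (2 * π * n)).quasiMeasurePreserving.ae
      (measure_eq_zero_iff_ae_notMem.1 h0)
  rw [Measure.bind_apply hs zigzagKernel.aemeasurable, lintegral_eq_zero_iff
    (zigzagKernel.measurable_coe hs)]
  filter_upwards [ae_all_iff.2 hae] with y hy
  simp [zigzagKernel_apply_apply y hs, hy]

end ZigzagKernel

section Zigzag

variable {X : Type*} [MeasurableSpace X] {M : Measure X} {φ : X → ℝ} {g : X → ℂ}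

theorem zigzag_integral {F : X → ℝ → ℂ} (hF : ∀ t, Integrable (fun p => F p t) M) (x : ℝ) :
    zigzag (fun t => ∫ p, F p t ∂M) x = ∫ p, zigzag (F p) x ∂M := by
  have hsub (s t : ℝ) : Integrable (fun p => F p s - F p t) M := (hF s).sub (hF t)
  simp only [zigzag]
  rw [integral_add (hF _) ((hsub _ _).const_mul _), integral_const_mul, integral_sub (hF _) (hF _)]

theorem zigzag_mul_const (f : ℝ → ℂ) (c : ℂ) (x : ℝ) :
    zigzag (fun t => f t * c) x = zigzag f x * c := by
  simp only [zigzag]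
  ring

theorem zigzag_fourierPushforward [SFinite M] (hφ : Measurable φ) (hg : Integrable g M) :
    zigzag (fourierPushforward M φ g) =
      fourierPushforward (M ⊗ₘ zigzagKernel.comap φ hφ) Prod.snd (g ∘ Prod.fst) := by
  have hg' := integrable_comp_fst_compProd (zigzagKernel.comap φ hφ) hg
  ext x
  calc zigzag (fourierPushforward M φ g) x
    _ = ∫ p, zigzag (fun t : ℝ => Complex.exp (Complex.I * t * φ p)) x * g p ∂M := by
      simp only [← zigzag_mul_const]
      exact zigzag_integral (integrable_exp_mul hφ hg) x
    _ = ∫ p, ∫ z : ℝ, Complex.exp (Complex.I * x * z) * g p ∂zigzagKernel (φ p) ∂M := by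
      simp only [integral_mul_const, integral_exp_zigzagKernel]
    _ = _ := (Measure.integral_compProd (integrable_exp_mul measurable_snd hg' x)).symm

theorem fourierPushforward_comp_fst_compProd [SFinite M] (κ : Kernel X ℝ) [IsMarkovKernel κ]
    (hφ : Measurable φ) (hg : Integrable g M) :
    fourierPushforward (M ⊗ₘ κ) (φ ∘ Prod.fst) (g ∘ Prod.fst) = fourierPushforward M φ g := by
  ext x
  have hint := integrable_exp_mul (hφ.comp measurable_fst) (integrable_comp_fst_compProd κ hg) x
  refine (Measure.integral_compProd hint).trans ?_
  simp [fourierPushforward]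

theorem normW_fourierPushforward_le_normW_zigzag_add [SFinite M] (hφ : Measurable φ)
    (hg : Integrable g M) :
    normW (fourierPushforward M φ g) ≤ normW (zigzag (fourierPushforward M φ g)) +
      2 * ∫⁻ p, ENNReal.ofReal (1 - zigzagWeight (φ p) 0) * ‖g p‖ₑ ∂M := by
  let κ := zigzagKernel.comap φ hφ
  have hφ' : Measurable fun p : X × ℝ => φ p.1 := hφ.comp measurable_fst
  calc normW (fourierPushforward M φ g)
    _ = normW (fourierPushforward (M ⊗ₘ κ) (φ ∘ Prod.fst) (g ∘ Prod.fst)) := by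
      rw [fourierPushforward_comp_fst_compProd κ hφ hg]
    _ ≤ normW (fourierPushforward (M ⊗ₘ κ) Prod.snd (g ∘ Prod.fst)) +
        2 * ∫⁻ p in {p | φ p.1 ≠ p.2}, ‖g p.1‖ₑ ∂(M ⊗ₘ κ) :=
      normW_fourierPushforward_le_add hφ' measurable_snd (integrable_comp_fst_compProd κ hg)
    _ ≤ _ := by
      have hne : MeasurableSet {p : X × ℝ | φ p.1 ≠ p.2} :=
        (measurableSet_eq_fun hφ' measurable_snd).compl
      rw [zigzag_fourierPushforward hφ hg,
        setLIntegral_compProd_comp_fst κ hg.aestronglyMeasurable.enorm hne]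
      gcongr with p
      refine (measure_mono fun z hz => ?_).trans (zigzagKernel_compl_singleton_le (φ p))
      exact Ne.symm hz

theorem tendsto_lintegral_one_sub_zigzagWeight_mul (hφ : Measurable φ) (hg : Integrable g M) :
    Tendsto (fun h => ∫⁻ p, ENNReal.ofReal (1 - zigzagWeight (h * φ p) 0) * ‖g p‖ₑ ∂M)
      (𝓝 0) (𝓝 0) := by
  have hcont := continuous_zigzagWeight 0
  rw [← lintegral_zero (μ := M)]
  refine tendsto_lintegral_filter_of_dominated_convergence' (fun p => ‖g p‖ₑ)
    (.of_forall fun h => ?_) (.of_forall fun h => .of_forall fun p => ?_) hg.2.ne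
    (.of_forall fun p => ?_)
  · have := hg.aestronglyMeasurable.enorm
    fun_prop
  · refine mul_le_of_le_one_left' (ENNReal.ofReal_le_one.2 ?_)
    linarith [zigzagWeight_nonneg (h * φ p) 0]
  · have hlim : Continuous fun h => ENNReal.ofReal (1 - zigzagWeight (h * φ p) 0) :=
      ENNReal.continuous_ofReal.comp (by fun_prop)
    simpa [zigzagWeight] using
      ENNReal.Tendsto.mul_const (b := ‖g p‖ₑ) (hlim.tendsto 0) (.inr enorm_ne_top)

end Zigzag

theorem zigzag_mem_W {f : ℝ → ℂ} (hf : f ∈ W) : zigzag f ∈ W := by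
  obtain ⟨m, _, g, hg, rfl⟩ := exists_eq_fourierPushforward_of_mem_W hf
  rw [zigzag_fourierPushforward measurable_id hg]
  exact fourierPushforward_mem_W measurable_snd (integrable_comp_fst_compProd _ hg)

theorem normW_zigzag_le {f : ℝ → ℂ} (hf : f ∈ W) : normW (zigzag f) ≤ normW f := by
  obtain ⟨m, _, g, hg, rfl⟩ := exists_eq_fourierPushforward_of_mem_W hf
  rw [zigzag_fourierPushforward measurable_id hg, normW_fourierPushforward .id hg]
  refine (normW_fourierPushforward_le measurable_snd
    (integrable_comp_fst_compProd _ hg)).trans_eq ?_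
  simpa using setLIntegral_compProd_comp_fst (zigzagKernel.comap id measurable_id)
    hg.aestronglyMeasurable.enorm .univ

theorem tendsto_normW_zigzag_comp_mul {f : ℝ → ℂ} (hf : f ∈ W) :
    Tendsto (fun h : ℝ => normW (zigzag fun x => f (h * x))) (𝓝[≠] 0) (𝓝 (normW f)) := by
  obtain ⟨m, _, g, hg, rfl⟩ := exists_eq_fourierPushforward_of_mem_W hf
  set f := fourierPushforward m id g
  set ε : ℝ → ℝ≥0∞ := fun h => 2 * ∫⁻ y, ENNReal.ofReal (1 - zigzagWeight (h * y) 0) * ‖g y‖ₑ ∂m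
  have hε : Tendsto ε (𝓝[≠] 0) (𝓝 0) := by
    simpa using ENNReal.Tendsto.const_mul (a := 2) ((tendsto_lintegral_one_sub_zigzagWeight_mul
      measurable_id hg).mono_left nhdsWithin_le_nhds) (.inr ENNReal.ofNat_ne_top)
  have hfin : normW f ≠ ∞ :=
    ((normW_fourierPushforward_le measurable_id hg).trans_lt hg.2).ne
  have hlow : Tendsto (fun h => normW f - ε h) (𝓝[≠] 0) (𝓝 (normW f)) := by
    simpa using ENNReal.Tendsto.sub tendsto_const_nhds hε (.inl hfin)
  refine tendsto_of_tendsto_of_tendsto_of_le_of_le' hlow tendsto_const_nhds ?_ ?_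
  · filter_upwards [self_mem_nhdsWithin] with h hh
    rw [tsub_le_iff_right, ← normW_comp_mul hf hh, fourierPushforward_comp_mul]
    exact normW_fourierPushforward_le_normW_zigzag_add (measurable_const_mul h) hg
  · filter_upwards [self_mem_nhdsWithin] with h hh
    refine (normW_zigzag_le ?_).trans_eq (normW_comp_mul hf hh)
    rw [fourierPushforward_comp_mul]
    exact fourierPushforward_mem_W (measurable_const_mul h) hg

theorem zigzag_mem_W₀ {f : ℝ → ℂ} (hf : f ∈ W₀) : zigzag f ∈ W₀ := by
  obtain ⟨g, hg, rfl⟩ := mem_W₀_iff.1 hf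
  have hg' := integrable_comp_fst_compProd (zigzagKernel.comap id measurable_id) hg
  rw [zigzag_fourierPushforward measurable_id hg, mem_W₀_iff]
  refine (isFourierIntegralOf_fourierPushforward measurable_snd hg').exists_eq_fourierPushforward
    (VectorMeasure.AbsolutelyContinuous.mk fun s hs h0 => ?_)
  have hsnd : (volume ⊗ₘ zigzagKernel.comap id measurable_id) (Prod.snd ⁻¹' s) = 0 := by
    rw [← Measure.snd_apply hs, Measure.snd_compProd, Kernel.comap_id]
    refine zigzagKernel_comp_volume_absolutelyContinuous ?_
    rwa [Measure.toENNRealVectorMeasure_apply_measurable hs] at h0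
  rw [VectorMeasure.map_apply _ measurable_snd hs, withDensityᵥ_apply hg' (measurable_snd hs)]
  exact setIntegral_measure_zero _ hsnd

theorem zigzag_mem_W₁ {f : ℝ → ℂ} (hf : f ∈ W₁) : zigzag f ∈ W₁ := by
  obtain ⟨c, f₀, hf₀, h⟩ := hf
  refine ⟨c, zigzag f₀, zigzag_mem_W₀ hf₀, fun x => ?_⟩
  simp only [zigzag, h]
  ring

theorem zigzag_mem_Wplus {f : ℝ → ℂ} (hf : f ∈ Wplus) : zigzag f ∈ Wplus := by
  obtain ⟨μ, _, h⟩ := hf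
  have hint (ν : Measure ℝ) [IsFiniteMeasure ν] (x : ℝ) :
      Integrable (fun y : ℝ => Complex.exp (Complex.I * x * y)) ν := by
    simpa using integrable_exp_mul measurable_id (integrable_const (μ := ν) 1) x
  refine ⟨zigzagKernel ∘ₘ μ, inferInstance, fun x => ?_⟩
  have hcomp := hint (zigzagKernel ∘ₘ μ) x
  rw [Measure.comp_eq_comp_const_apply] at hcomp ⊢
  rw [Kernel.integral_comp hcomp, Kernel.const_apply, funext h, zigzag_integral (hint μ)]
  simp only [integral_exp_zigzagKernel]

theorem one_le_of_normW_zigzag_le {C : ℝ≥0∞}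
    (hC : ∀ f ∈ W, normW (zigzag f) ≤ C * normW f) : 1 ≤ C := by
  have hint : Integrable (fun _ : ℝ => (1 : ℂ)) (Measure.dirac 0) := integrable_const 1
  have hone : fourierPushforward (Measure.dirac 0) id (fun _ => 1) = fun _ => 1 := by
    ext x
    simp [fourierPushforward]
  have hmem := hone ▸ fourierPushforward_mem_W measurable_id hint
  have hnorm : normW (fun _ => 1) = 1 := by
    rw [← hone, normW_fourierPushforward .id hint]
    simp
  have hzigzag : zigzag (fun _ => 1) = fun _ => 1 := by
    ext x
    simp [zigzag]
  simpa [hzigzag, hnorm] using hC _ hmem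

end WienerAlgebra

theorem theorem2 :
    (∀ f ∈ WienerAlgebra.W,
      WienerAlgebra.zigzag f ∈ WienerAlgebra.W ∧
        WienerAlgebra.normW (WienerAlgebra.zigzag f) ≤ WienerAlgebra.normW f) ∧
    (∀ C : ℝ≥0∞,
      (∀ f ∈ WienerAlgebra.W,
        WienerAlgebra.normW (WienerAlgebra.zigzag f) ≤ C * WienerAlgebra.normW f) → 1 ≤ C) ∧
    (∀ f ∈ WienerAlgebra.W,
      Tendsto (fun h : ℝ => WienerAlgebra.normW (WienerAlgebra.zigzag (fun x : ℝ => f (h * x))))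
        (𝓝[>] 0) (𝓝 (WienerAlgebra.normW f))) ∧
    (∀ f ∈ WienerAlgebra.W₀, WienerAlgebra.zigzag f ∈ WienerAlgebra.W₀) ∧
    (∀ f ∈ WienerAlgebra.W₁, WienerAlgebra.zigzag f ∈ WienerAlgebra.W₁) ∧
    (∀ f ∈ WienerAlgebra.Wplus, WienerAlgebra.zigzag f ∈ WienerAlgebra.Wplus) :=
  ⟨fun _ hf => ⟨WienerAlgebra.zigzag_mem_W hf, WienerAlgebra.normW_zigzag_le hf⟩,
    fun _ => WienerAlgebra.one_le_of_normW_zigzag_le,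
    fun _ hf => (WienerAlgebra.tendsto_normW_zigzag_comp_mul hf).mono_left (nhdsGT_le_nhdsNE 0),
    fun _ => WienerAlgebra.zigzag_mem_W₀,
    fun _ => WienerAlgebra.zigzag_mem_W₁,
    fun _ => WienerAlgebra.zigzag_mem_Wplus⟩
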